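/- Consider a $K$-user MIMO interference channel with $N_t$ transmit and $N_r$ receive antennas and one data stream per user ($d=1$). The true channel from transmitter $i$ to receiver $k$ is $H_{ki}=\hat H_{ki}+E_{ki}$, where $\hat H_{ki}\in\mathbb C^{N_r\times N_t}$ is known and $E_{ki}=\Sigma_r^{1/2}H^{(w)}_{ki}\Sigma_t^{1/2}$, with positive semidefinite correlation matrices $\Sigma_r,\Sigma_t$ and with the entries of $H^{(w)}_{ki}$ i.i.d. circularly symmetric $\mathcal{CN}(0,\sigma_h^2)$, $\sigma_h^2\ge 0$; the $E_{ki}$ are independent across pairs $(k,i)$. Let $v_i\in\mathbb C^{N_t}$ be the unit-norm transmit beamforming vectors, $u_k\in\mathbb C^{N_r}$ the unit-norm receive filters, $\sigma^2>0$ the noise variance, and $$\mathsf{SINR}_k=\frac{|u_k^H\hat H_{kk}v_k|^2}{|u_k^HE_{kk}v_k|^2+\sum_{i\ne k}|u_k^H(\hat H_{ki}+E_{ki})v_i|^2+\sigma^2}.$$ Fix a user $k$ and a target rate $R_k>0$, and put $\tau=\frac{|u_k^H\hat H_{kk}v_k|^2}{2^{R_k}-1}-\sigma^2$. Let $X_k\in\mathbb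 C^K$ be the random vector with entries $X_{kk}=u_k^HE_{kk}v_k$ and $X_{ki}=u_k^H(\hat H_{ki}+E_{ki})v_i$ for $i\neq k$, let $\mu_k=\mathbb E\{X_k\}$ be its mean and $\Sigma_k=\mathbb E\{(X_k-\mu_k)(X_k-\mu_k)^H\}$ its covariance matrix. Suppose that $\tau\ge 0$, that $\Sigma_k$ is positive definite and that all its $K$ eigenvalues are distinct. Let $\Sigma_k=\Psi\Lambda\Psi^H$ be any eigendecomposition, with $\Psi$ unitary and $\Lambda=\mathrm{diag}(\lambda_1,\dots,\lambda_K)$, let $\chi=(\chi_1,\dots,\chi_K)^T=\Lambda^{-1/2}\Psi^H\mu_k$, and for $1\le i\le K$ let $$g_i(s)=\frac{e^{\tau s}}{s-1/\lambda_i}\cdot\frac{\exp\Big(-\sum_{p\ne i}\frac{\lambda_p(s-1/\lambda_i)}{1+\lambda_p(s-1/\lambda_i)}|\chi_p|^2\Big)}{\prod_{p\ne i}\big(1+\lambda_p(s-1/\lambda_i)\big)}.$$ Then the outage probability of user $k$ is $$\Pr\{\log_2(1+\mathsf{SINR}_k)\le R_k\}=-\sum_{i=1}^K\frac{e^{-(|\chi_i|^2+\tau/\lambda_i)}}{\lambda_i}\sum_{n=0}^\infty\Big(\frac1{n!}\Big)^2\Big(\frac{|\chi_i|^2}{\lambda_i}\Big)^n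 g_i^{(n)}(0),$$ where all $K$ infinite series converge absolutely. -/

import Mathlib

open MeasureTheory ProbabilityTheory Matrix
open scoped NNReal ComplexOrder MatrixOrder Nat

noncomputable section

/-- The circularly symmetric complex Gaussian law `CN(0, v)`: real and imaginary parts are
independent real Gaussians with mean `0` and variance `v / 2`. -/
def complexGaussian (v : ℝ≥0) : Measure ℂ :=
  ((gaussianReal 0 (v / 2)).prod (gaussianReal 0 (v / 2))).map
    (fun p : ℝ × ℝ => (p.1 : ℂ) + (p.2 : ℂ) * Complex.I)

/-- The deterministic data of a `K`-user MIMO interference channel with `Nt` transmit and `Nr`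
receive antennas, one data stream per user, and imperfect channel knowledge. -/
structure InterferenceChannel (K Nt Nr : ℕ) where
  /-- available channel matrices; `Hhat k i` is from transmitter `i` to receiver `k` -/
  Hhat : Fin K → Fin K → Matrix (Fin Nr) (Fin Nt) ℂ
  /-- transmit antenna correlation matrix -/
  St : Matrix (Fin Nt) (Fin Nt) ℂ
  /-- receive antenna correlation matrix -/
  Sr : Matrix (Fin Nr) (Fin Nr) ℂ
  /-- CSI uncertainty level (a variance) -/
  sigmaH2 : ℝ≥0
  /-- variance of the thermal noise -/
  sigma2 : ℝ
  /-- transmit beamforming vectors -/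
  v : Fin K → Fin Nt → ℂ
  /-- receive filters -/
  u : Fin K → Fin Nr → ℂ
  posSemidef_St : St.PosSemidef
  posSemidef_Sr : Sr.PosSemidef
  sigma2_pos : 0 < sigma2
  norm_v : ∀ i, ∑ a, ‖v i a‖ ^ 2 = 1
  norm_u : ∀ k, ∑ b, ‖u k b‖ ^ 2 = 1

namespace InterferenceChannel

variable {K Nt Nr : ℕ} {Ω : Type*} [MeasurableSpace Ω]

/-- `u_kᴴ A v_i`, the scalar response seen by user `k` on a link `A` from transmitter `i`. -/
def response (S : InterferenceChannel K Nt Nr) (k i : Fin K)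
    (A : Matrix (Fin Nr) (Fin Nt) ℂ) : ℂ :=
  star (S.u k) ⬝ᵥ (A *ᵥ S.v i)

/-- The CSI error `E_ki = Σ_r^{1/2} W_ki Σ_t^{1/2}` (Kronecker model; `CFC.sqrt` is the positive
semidefinite square root). -/
def csiError (S : InterferenceChannel K Nt Nr)
    (W : Fin K → Fin K → Ω → Matrix (Fin Nr) (Fin Nt) ℂ) (k i : Fin K) (ω : Ω) :
    Matrix (Fin Nr) (Fin Nt) ℂ :=
  CFC.sqrt S.Sr * W k i ω * CFC.sqrt S.St

/-- The distributional assumptions of the CSI error model: for each pair the entries of `W_ki`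
are i.i.d. `CN(0, σ_h²)`, and the error matrices of different pairs are independent. -/
structure IsKroneckerModel (S : InterferenceChannel K Nt Nr)
    (W : Fin K → Fin K → Ω → Matrix (Fin Nr) (Fin Nt) ℂ) (P : Measure Ω) : Prop where
  law_entry : ∀ k i b a, HasLaw (fun ω => W k i ω b a) (complexGaussian S.sigmaH2) P
  indep_entry : ∀ k i, iIndepFun (fun (q : Fin Nr × Fin Nt) ω => W k i ω q.1 q.2) P
  indep_pair : iIndepFun
    (fun (p : Fin K × Fin K) ω (q : Fin Nr × Fin Nt) => S.csiError W p.1 p.2 ω q.1 q.2) P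

/-- The SINR of user `k`. -/
def sinr (S : InterferenceChannel K Nt Nr)
    (W : Fin K → Fin K → Ω → Matrix (Fin Nr) (Fin Nt) ℂ) (k : Fin K) (ω : Ω) : ℝ :=
  ‖S.response k k (S.Hhat k k)‖ ^ 2 /
    (‖S.response k k (S.csiError W k k ω)‖ ^ 2
      + ∑ i ∈ Finset.univ.erase k, ‖S.response k i (S.Hhat k i + S.csiError W k i ω)‖ ^ 2
      + S.sigma2)

/-- The probability that the supportable rate of user `k` does not exceed the target rate `R`. -/
def outageProb (S : InterferenceChannel K Nt Nr)
    (W : Fin K → Fin K → Ω → Matrix (Fin Nr) (Fin Nt) ℂ) (P : Measure Ω) (k : Fin K)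
    (R : ℝ) : ℝ :=
  P.real {ω | Real.logb 2 (1 + S.sinr W k ω) ≤ R}

/-- The threshold `τ = |u_kᴴ Ĥ_kk v_k|² / (2^R - 1) - σ²`. -/
def threshold (S : InterferenceChannel K Nt Nr) (k : Fin K) (R : ℝ) : ℝ :=
  ‖S.response k k (S.Hhat k k)‖ ^ 2 / ((2 : ℝ) ^ R - 1) - S.sigma2

/-- The random vector `X_k`. -/
def interference (S : InterferenceChannel K Nt Nr)
    (W : Fin K → Fin K → Ω → Matrix (Fin Nr) (Fin Nt) ℂ) (k : Fin K) (ω : Ω) : Fin K → ℂ :=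
  fun i => if i = k then S.response k k (S.csiError W k k ω)
    else S.response k i (S.Hhat k i + S.csiError W k i ω)

/-- The mean vector of `X_k`. -/
def meanVec (S : InterferenceChannel K Nt Nr)
    (W : Fin K → Fin K → Ω → Matrix (Fin Nr) (Fin Nt) ℂ) (P : Measure Ω) (k : Fin K) :
    Fin K → ℂ :=
  fun i => ∫ ω, S.interference W k ω i ∂P

/-- The covariance matrix `E[(X_k - μ_k)(X_k - μ_k)ᴴ]` of `X_k`. -/
def covMatrix (S : InterferenceChannel K Nt Nr)
    (W : Fin K → Fin K → Ω → Matrix (Fin Nr) (Fin Nt) ℂ) (P : Measure Ω) (k : Fin K) :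
    Matrix (Fin K) (Fin K) ℂ :=
  Matrix.of fun i j => ∫ ω, (S.interference W k ω i - S.meanVec W P k i)
    * star (S.interference W k ω j - S.meanVec W P k j) ∂P

end InterferenceChannel

/-- `χ = Λ^{-1/2} Ψᴴ μ` for `Λ = diag(lam)`. -/
def whitenedMean {K : ℕ} (Ψ : Matrix (Fin K) (Fin K) ℂ) (lam : Fin K → ℝ) (μ : Fin K → ℂ) :
    Fin K → ℂ :=
  Matrix.diagonal (fun i => (((Real.sqrt (lam i))⁻¹ : ℝ) : ℂ)) *ᵥ (Ψᴴ *ᵥ μ)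

/-- The function `g_i(s)` of the complex variable `s`. -/
def gFun {K : ℕ} (lam : Fin K → ℝ) (χ : Fin K → ℂ) (τ : ℝ) (i : Fin K) (s : ℂ) : ℂ :=
  Complex.exp (τ * s) / (s - 1 / lam i) *
    (Complex.exp (-∑ p ∈ Finset.univ.erase i,
        lam p * (s - 1 / lam i) / (1 + lam p * (s - 1 / lam i)) * (‖χ p‖ : ℂ) ^ 2) /
      ∏ p ∈ Finset.univ.erase i, (1 + lam p * (s - 1 / lam i)))

end

/-!
The outage event is `{Y ≥ τ}` with `Y = ‖X_k‖²` (`InterferenceChannel.outageProb_eq`). The links to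
user `k` are independent, so `X_k` has independent complex Gaussian entries, and its covariance
matrix is diagonal (`IsKroneckerModel.covMatrix_eq`). As the eigenvalues are distinct, the unitary
matrix of any eigendecomposition is a permutation matrix up to phases
(`exists_perm_of_diagonal_eq_unitary_conj`). Hence `Y` is a sum of independent noncentral
chi-square variables with scales `λ_i` and noncentralities `|χ_i|²`, and `E e^{-sY} = M(s)`, for
imaginary `s`, with `M = ∏ φ_i` and `φ_i(s) = exp(-λ_i s |χ_i|² / (1 + λ_i s)) / (1 + λ_i s)`.

Each `φ_i` is holomorphic off the essential singularity `-1/λ_i` and vanishes at infinity. Such a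
function is the Cauchy transform of its values on a small circle `C_i` around the singularity, and
the partial fraction identity for the product of two Cauchy kernels extends this to the product:
`M(s) = ∑ (2πi)⁻¹ ∮_{C_i} M(z)/(s - z) dz` outside the discs (`prod_eq_sum_circleIntegral`). Since
`1/(s - z) = ∫_0^∞ e^{-t(s - z)} dt`, this says that `M` is the transform of
`f(t) = ∑ (2πi)⁻¹ ∮_{C_i} e^{tz} M(z) dz` on `(0, ∞)`, so `f` is the density of `Y`, by uniqueness of
characteristic functions (`measureReal_eq_setIntegral_complex_of_charFun`; no a priori positivity
or reality of `f` is used). Integrating over `[τ, ∞)` gives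
`P(Y ≥ τ) = -∑ (2πi)⁻¹ ∮_{C_i} e^{τz} M(z)/z dz`.

With `z = -1/λ_i + w`, the `i`-th integrand is a constant times `exp(a/w)/w * g_i(w)`, where
`a = |χ_i|²/λ_i` and `g_i` is analytic at `0` (`prod_noncentralMGF_eq`). Expanding `exp(a/w)` and
applying Cauchy's formula for derivatives termwise gives the absolutely convergent series
(`hasSum_circleIntegral_exp_div`).
-/

open Filter Topology Set Metric

/-! ### Cauchy integrals around essential singularities -/

/-- Cauchy's formula for the exterior of a disc: a function with a single, possibly essential,
singularity that vanishes at infinity is the Cauchy transform of its values on a circle around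
the singularity. -/
theorem two_pi_I_inv_mul_circleIntegral_div_sub_of_tendsto_zero {g : ℂ → ℂ} {c s : ℂ} {r : ℝ}
    (hr : 0 < r) (hg : DifferentiableOn ℂ g {c}ᶜ) (h0 : Tendsto g (Bornology.cobounded ℂ) (𝓝 0))
    (hs : r < dist s c) :
    (2 * Real.pi * Complex.I)⁻¹ * (∮ z in C(c, r), g z / (s - z)) = g s := by
  have hsc : s ∈ ({c}ᶜ : Set ℂ) := by
    rintro rfl
    simp at hs
    linarith
  have hnhds : ({c}ᶜ : Set ℂ) ∈ 𝓝 s := isOpen_compl_singleton.mem_nhds hsc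
  have hF : DifferentiableOn ℂ (dslope g s) {c}ᶜ := (Complex.differentiableOn_dslope hnhds).2 hg
  have hgcont : ∀ ρ, 0 < ρ → ContinuousOn g (sphere c ρ) := fun ρ hρ =>
    hg.continuousOn.mono fun z hz h => by
      rw [mem_singleton_iff] at h
      simp [h] at hz
      exact hρ.ne' hz.symm
  -- both circle integrals, in terms of the divided difference of `g` at `s`
  have key : ∀ ρ, 0 < ρ → ρ ≠ dist s c → (∮ z in C(c, ρ), dslope g s z) =
      (∮ z in C(c, ρ), (z - s)⁻¹ * g z) - g s * ∮ z in C(c, ρ), (z - s)⁻¹ := by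
    intro ρ hρ hne
    have hzs : ∀ z ∈ sphere c ρ, z ≠ s := by
      rintro z hz rfl
      exact hne (mem_sphere.1 hz).symm
    have hinv : ContinuousOn (fun z : ℂ => (z - s)⁻¹) (sphere c ρ) :=
      ContinuousOn.inv₀ (by fun_prop) fun z hz => sub_ne_zero.2 (hzs z hz)
    rw [← circleIntegral.integral_const_mul, ← circleIntegral.integral_sub]
    · refine circleIntegral.integral_congr hρ.le fun z hz => ?_
      simp only [dslope_of_ne _ (hzs z hz), slope, vsub_eq_sub, smul_eq_mul]
      ring
    · exact (hinv.mul (hgcont ρ hρ)).circleIntegrable hρ.le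
    · exact (hinv.const_smul (g s)).circleIntegrable hρ.le
  have hsmall : (∮ z in C(c, r), (z - s)⁻¹) = 0 := by
    refine DiffContOnCl.circleIntegral_eq_zero hr.le (DifferentiableOn.diffContOnCl ?_)
    rw [closure_ball c hr.ne']
    refine DifferentiableOn.inv (by fun_prop) fun z hz => sub_ne_zero.2 ?_
    rintro rfl
    exact absurd (mem_closedBall.1 hz) (not_le.2 hs)
  have hmain : ∀ ρ, dist s c < ρ →
      (∮ z in C(c, r), (z - s)⁻¹ * g z) + 2 * Real.pi * Complex.I * g s =
        ∮ z in C(c, ρ), (z - s)⁻¹ * g z := by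
    intro ρ hρ
    have hann : (∮ z in C(c, ρ), dslope g s z) = ∮ z in C(c, r), dslope g s z := by
      refine Complex.circleIntegral_eq_of_differentiable_on_annulus_off_countable hr
        (hs.trans hρ).le countable_empty (hF.continuousOn.mono ?_) ?_
      · rintro z ⟨-, hz⟩ h
        rw [mem_singleton_iff] at h
        exact hz (by simpa [h] using hr)
      · rintro z ⟨⟨-, hz⟩, -⟩
        refine hF.differentiableAt (isOpen_compl_singleton.mem_nhds fun h => hz ?_)
        rw [mem_singleton_iff] at h
        simpa [h] using hr.le
    rw [key ρ (by linarith) hρ.ne', key r hr hs.ne, hsmall,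
      circleIntegral.integral_sub_inv_of_mem_ball (mem_ball.2 hρ)] at hann
    linear_combination -hann
  -- on the large circle the Cauchy kernel is `O(1/ρ)` while `g` tends to zero
  have hlim : Tendsto (fun ρ : ℝ => ∮ z in C(c, ρ), (z - s)⁻¹ * g z) atTop (𝓝 0) := by
    rw [Metric.tendsto_nhds]
    intro ε hε
    have hε' : 0 < ε / (8 * Real.pi) := by positivity
    have h1 : ∀ᶠ z in Bornology.cobounded ℂ, ‖g z‖ < ε / (8 * Real.pi) := by
      simpa [dist_zero_right] using (Metric.tendsto_nhds.1 h0) _ hε'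
    obtain ⟨B, -, hB⟩ := (Metric.hasBasis_cobounded_compl_closedBall c).eventually_iff.1 h1
    filter_upwards [eventually_gt_atTop B, eventually_gt_atTop (2 * dist s c),
      eventually_gt_atTop 0] with ρ h1 h2 h3
    rw [dist_zero_right]
    have hbound : ∀ z ∈ sphere c ρ, ‖(z - s)⁻¹ * g z‖ ≤ 2 / ρ * (ε / (8 * Real.pi)) := by
      intro z hz
      rw [norm_mul, norm_inv, ← dist_eq_norm]
      have hz' := mem_sphere.1 hz
      have h4 : ρ / 2 ≤ dist z s := by
        have := dist_triangle z s c
        linarith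
      have h5 := (hB (x := z) (by simp [hz', h1])).le
      have : (dist z s)⁻¹ ≤ 2 / ρ := by
        rw [← inv_div]
        exact inv_anti₀ (by positivity) h4
      gcongr
    have := circleIntegral.norm_integral_le_of_norm_le_const h3.le hbound
    have e : 2 * Real.pi * ρ * (2 / ρ * (ε / (8 * Real.pi))) = ε / 2 := by
      field_simp
      ring
    linarith
  have hzero := tendsto_nhds_unique hlim (tendsto_const_nhds.congr'
    ((eventually_gt_atTop (dist s c)).mono fun ρ hρ => hmain ρ hρ))
  have hneg : (∮ z in C(c, r), g z / (s - z)) = -∮ z in C(c, r), (z - s)⁻¹ * g z := by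
    rw [← neg_one_mul, ← circleIntegral.integral_const_mul]
    refine circleIntegral.integral_congr hr.le fun z _ => ?_
    rw [← neg_sub z s, div_neg, div_eq_inv_mul]
    ring
  rw [hneg, inv_mul_eq_iff_eq_mul₀ Complex.two_pi_I_ne_zero]
  linear_combination hzero

theorem circleIntegral_circleIntegral_swap {f : ℂ → ℂ → ℂ} {c d : ℂ} {r ρ : ℝ} (hr : 0 ≤ r)
    (hρ : 0 ≤ ρ) (hf : ContinuousOn (Function.uncurry f) (sphere c r ×ˢ sphere d ρ)) :
    (∮ z in C(c, r), ∮ y in C(d, ρ), f z y) = ∮ y in C(d, ρ), ∮ z in C(c, r), f z y := by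
  have hc : Continuous fun p : ℝ × ℝ => f (circleMap c r p.1) (circleMap d ρ p.2) := by
    refine hf.comp_continuous (f := fun p : ℝ × ℝ => (circleMap c r p.1, circleMap d ρ p.2))
      ?_ fun p => ⟨?_, ?_⟩
    · exact ((continuous_circleMap c r).comp continuous_fst).prodMk
        ((continuous_circleMap d ρ).comp continuous_snd)
    · exact circleMap_mem_sphere c hr _
    · exact circleMap_mem_sphere d hρ _
  simp only [circleIntegral, deriv_circleMap, smul_eq_mul]
  simp only [← intervalIntegral.integral_const_mul]
  rw [intervalIntegral_intervalIntegral_swap]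
  · simp only [mul_left_comm]
  · have hc' : Continuous fun p : ℝ × ℝ => circleMap 0 r p.1 * Complex.I *
        (circleMap 0 ρ p.2 * Complex.I * f (circleMap c r p.1) (circleMap d ρ p.2)) := by
      have h1 := (continuous_circleMap 0 r).comp (continuous_fst (X := ℝ) (Y := ℝ))
      have h2 := (continuous_circleMap 0 ρ).comp (continuous_snd (X := ℝ) (Y := ℝ))
      exact (h1.mul continuous_const).mul ((h2.mul continuous_const).mul hc)
    exact (hc'.continuousOn.integrableOn_compact (isCompact_uIcc.prod isCompact_uIcc)).mono_set
      (prod_mono uIoc_subset_uIcc uIoc_subset_uIcc)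

/-- A circle integral depending continuously on a parameter in a circle is circle integrable. -/
theorem circleIntegrable_circleIntegral {f : ℂ → ℂ → ℂ} {c d : ℂ} {r ρ : ℝ} (hr : 0 ≤ r)
    (hρ : 0 ≤ ρ) (hf : ContinuousOn (Function.uncurry f) (sphere c r ×ˢ sphere d ρ)) :
    CircleIntegrable (fun y => ∮ z in C(c, r), f z y) d ρ := by
  refine Continuous.intervalIntegrable ?_ _ _
  simp only [circleIntegral, deriv_circleMap, smul_eq_mul]
  refine intervalIntegral.continuous_parametric_intervalIntegral_of_continuous' ?_ _ _
  have h1 : Continuous fun p : ℝ × ℝ => f (circleMap c r p.2) (circleMap d ρ p.1) := by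
    refine hf.comp_continuous (f := fun p : ℝ × ℝ => (circleMap c r p.2, circleMap d ρ p.1))
      ?_ fun p => ⟨?_, ?_⟩
    · exact ((continuous_circleMap c r).comp continuous_snd).prodMk
        ((continuous_circleMap d ρ).comp continuous_fst)
    · exact circleMap_mem_sphere c hr _
    · exact circleMap_mem_sphere d hρ _
  exact (((continuous_circleMap 0 r).comp continuous_snd).mul continuous_const).mul h1

/-- Partial fractions for a product of functions with distinct essential singularities: it is the
sum of its principal parts, each written as a Cauchy integral around one singularity. At least
one factor is needed, since the empty product does not vanish at infinity. -/
theorem prod_eq_sum_circleIntegral {ι : Type*} {g : ι → ℂ → ℂ} {c : ι → ℂ} {r : ℝ} (hr : 0 < r)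
    (hg : ∀ i, DifferentiableOn ℂ (g i) {c i}ᶜ)
    (h0 : ∀ i, Tendsto (g i) (Bornology.cobounded ℂ) (𝓝 0))
    (hdisj : Pairwise fun i j => 2 * r < dist (c i) (c j)) {T : Finset ι} (hT : T.Nonempty) :
    ∀ s, (∀ i ∈ T, r < dist s (c i)) → ∏ i ∈ T, g i s =
      ∑ i ∈ T, (2 * Real.pi * Complex.I)⁻¹ * ∮ z in C(c i, r), (∏ p ∈ T, g p z) / (s - z) := by
  have hne : ∀ i j, ∀ z ∈ sphere (c i) r, z ≠ c j := by
    rintro i j z hz rfl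
    rcases eq_or_ne i j with rfl | hij
    · simp at hz
      exact hr.ne hz
    · have := hdisj hij
      rw [mem_sphere, dist_comm] at hz
      linarith
  have hfar : ∀ i j, i ≠ j → ∀ z ∈ sphere (c i) r, r < dist z (c j) := by
    intro i j hij z hz
    have := hdisj hij
    have := dist_triangle_left (c i) (c j) z
    rw [mem_sphere] at hz
    linarith
  have hcont : ∀ i j, ContinuousOn (g j) (sphere (c i) r) := fun i j =>
    (hg j).continuousOn.mono fun z hz => hne i j z hz
  induction hT using Finset.Nonempty.cons_induction with
  | singleton k =>
    intro s hs
    simp only [Finset.prod_singleton, Finset.sum_singleton]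
    exact (two_pi_I_inv_mul_circleIntegral_div_sub_of_tendsto_zero hr (hg k) (h0 k)
      (hs k (by simp))).symm
  | cons k T hk hT ih =>
    intro s hs
    have hsk : r < dist s (c k) := hs k (by simp)
    have hsT : ∀ i ∈ T, r < dist s (c i) := fun i hi => hs i (by simp [hi])
    have hs0 : ∀ i ∈ Finset.cons k T hk, ∀ z ∈ sphere (c i) r, s - z ≠ 0 := by
      intro i hi z hz h
      rw [sub_eq_zero] at h
      have := hs i hi
      rw [h, mem_sphere.1 hz] at this
      exact this.false
    set M : ℂ → ℂ := fun z => ∏ p ∈ T, g p z with hM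
    have hMcont : ∀ i, ContinuousOn M (sphere (c i) r) := fun i =>
      continuousOn_finsetProd _ fun p _ => hcont i p
    set κ : ℂ := (2 * Real.pi * Complex.I)⁻¹ with hκ
    have hk1 : ∀ z, r < dist z (c k) → κ * (∮ y in C(c k, r), g k y / (z - y)) = g k z :=
      fun z hz => two_pi_I_inv_mul_circleIntegral_div_sub_of_tendsto_zero hr (hg k) (h0 k) hz
    simp only [Finset.prod_cons, Finset.sum_cons]
    have hki : ∀ i ∈ T, k ≠ i := fun i hi h => hk (h ▸ hi)
    -- partial fractions `1/((s-z)(s-y)) = (1/(s-z) - 1/(s-y))/(z-y)` under the double integral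
    have hpair : ∀ i ∈ T, κ * (∮ z in C(c i, r), M z / (s - z)) * g k s =
        κ * (∮ z in C(c i, r), g k z * M z / (s - z)) +
          κ * ∮ y in C(c k, r), g k y / (s - y) * (κ * ∮ z in C(c i, r), M z / (y - z)) ∧
        CircleIntegrable
          (fun y => g k y / (s - y) * (κ * ∮ z in C(c i, r), M z / (y - z))) (c k) r := by
      intro i hi
      have hik : i ≠ k := (hki i hi).symm
      have hzy : ∀ z ∈ sphere (c i) r, ∀ y ∈ sphere (c k) r, z - y ≠ 0 := by
        intro z hz y hy h
        rw [sub_eq_zero] at h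
        have := hfar i k hik z hz
        rw [h, mem_sphere.1 hy] at this
        exact this.false
      have hi' : i ∈ Finset.cons k T hk := by simp [hi]
      have hk' : k ∈ Finset.cons k T hk := by simp
      have hM2 : ContinuousOn (fun p : ℂ × ℂ => M p.1) (sphere (c i) r ×ˢ sphere (c k) r) :=
        (hMcont i).comp continuousOn_fst fun p hp => hp.1
      have hgk : ContinuousOn (fun y => g k y / (s - y)) (sphere (c k) r) :=
        (hcont k k).div (by fun_prop) fun y hy => hs0 k hk' y hy
      have hker : ContinuousOn (fun p : ℂ × ℂ => M p.1 / (p.2 - p.1))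
          (sphere (c i) r ×ˢ sphere (c k) r) := by
        refine hM2.div (by fun_prop) fun p hp => ?_
        rw [← neg_ne_zero, neg_sub]
        exact hzy _ hp.1 _ hp.2
      refine ⟨?_, ((circleIntegrable_circleIntegral (f := fun z y => M z / (y - z))
        hr.le hr.le hker).const_smul
        (a := κ)).continuousOn_mul (by rwa [abs_of_pos hr])⟩
      have hswap : (∮ y in C(c k, r), g k y / (s - y) * (κ * ∮ z in C(c i, r), M z / (y - z))) =
          ∮ z in C(c i, r), ∮ y in C(c k, r), g k y / (s - y) * (κ * (M z / (y - z))) := by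
        rw [circleIntegral_circleIntegral_swap hr.le hr.le]
        · simp only [circleIntegral.integral_const_mul]
        · exact (hgk.comp continuousOn_snd fun p hp => hp.2).mul (continuousOn_const.mul hker)
      have hinner : ∀ z ∈ sphere (c i) r,
          (∮ y in C(c k, r), g k y / (s - y) * (κ * (M z / (y - z)))) =
            g k s * (M z / (s - z)) - g k z * M z / (s - z) := by
        intro z hz
        rw [← hk1 s hsk, ← hk1 z (hfar i k hik z hz)]
        have e : ∀ A B : ℂ, κ * A * (M z / (s - z)) - κ * B * M z / (s - z) =
            κ * (M z / (s - z)) * (A - B) := fun A B => by ring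
        rw [e, ← circleIntegral.integral_sub, ← circleIntegral.integral_const_mul]
        · refine circleIntegral.integral_congr hr.le fun y hy => ?_
          have h1 := hs0 i hi' z hz
          have h2 := hs0 k hk' y hy
          have h3 := hzy z hz y hy
          have h4 : y - z ≠ 0 := by rwa [← neg_ne_zero, neg_sub]
          field_simp
          ring
        · exact hgk.circleIntegrable hr.le
        · exact ((hcont k k).div (by fun_prop) fun y hy => hzy z hz y hy).circleIntegrable hr.le
      rw [hswap, circleIntegral.integral_congr hr.le hinner, circleIntegral.integral_sub,
        circleIntegral.integral_const_mul]
      · ring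
      · exact (((hMcont i).div (by fun_prop) fun z hz => hs0 i hi' z hz).const_smul
          (g k s)).circleIntegrable hr.le
      · exact (((hcont i k).mul (hMcont i)).div (by fun_prop)
          fun z hz => hs0 i hi' z hz).circleIntegrable hr.le
    rw [ih s hsT, mul_comm, Finset.sum_mul, Finset.sum_congr rfl fun i hi => (hpair i hi).1,
      Finset.sum_add_distrib, add_comm]
    congr 1
    rw [← Finset.mul_sum, ← circleIntegral.integral_fun_sum fun i hi => (hpair i hi).2]
    congr 1
    refine circleIntegral.integral_congr hr.le fun z hz => ?_
    rw [← Finset.mul_sum, ← ih z fun i hi => hfar k i (hki i hi) z hz]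
    ring

/-- The residue of `exp (a / w) / w * g w` at the essential singularity `0`, as a series in the
Taylor coefficients of `g`. -/
theorem hasSum_circleIntegral_exp_div {g : ℂ → ℂ} {r : ℝ} (hr : 0 < r)
    (hg : DifferentiableOn ℂ g (closedBall 0 r)) (a : ℂ) :
    HasSum (fun n : ℕ => (1 / (n ! : ℂ)) ^ 2 * a ^ n * iteratedDeriv n g 0)
      ((2 * Real.pi * Complex.I)⁻¹ * ∮ w in C(0, r), Complex.exp (a / w) / w * g w) := by
  have hgc : ContinuousOn g (sphere 0 r) := hg.continuousOn.mono sphere_subset_closedBall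
  have hw0 : ∀ w ∈ sphere (0 : ℂ) r, w ≠ 0 := fun w hw => ne_of_mem_sphere hw hr.ne'
  obtain ⟨C, hC⟩ := (isCompact_sphere (0 : ℂ) r).exists_bound_of_continuousOn hgc
  have hterm : ∀ n : ℕ, (1 / (n ! : ℂ)) ^ 2 * a ^ n * iteratedDeriv n g 0 =
      (2 * Real.pi * Complex.I)⁻¹ * ∮ w in C(0, r), (a / w) ^ n / (n ! : ℂ) / w * g w := by
    intro n
    have h1 := hg.circleIntegral_one_div_sub_center_pow_smul hr n
    have h2 : (∮ w in C(0, r), (a / w) ^ n / (n ! : ℂ) / w * g w) =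
        a ^ n / n ! * ∮ w in C(0, r), (1 / (w - 0) ^ (n + 1)) • g w := by
      rw [← circleIntegral.integral_const_mul]
      refine circleIntegral.integral_congr hr.le fun w hw => ?_
      have := hw0 w hw
      have : (n ! : ℂ) ≠ 0 := mod_cast n.factorial_ne_zero
      simp only [sub_zero, smul_eq_mul]
      rw [div_pow, pow_succ]
      field_simp
    rw [h2, h1, smul_eq_mul]
    have h3 : (n ! : ℂ) ≠ 0 := mod_cast n.factorial_ne_zero
    have h4 := Complex.two_pi_I_ne_zero
    field_simp
  simp only [hterm]
  refine HasSum.mul_left _ ?_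
  simp only [circleIntegral, deriv_circleMap, smul_eq_mul]
  have hcirc : ∀ θ, circleMap 0 r θ ∈ sphere (0 : ℂ) r := circleMap_mem_sphere 0 hr.le
  have hgcirc : Continuous fun θ => g (circleMap 0 r θ) :=
    hgc.comp_continuous (continuous_circleMap 0 r) hcirc
  have hcirc0 : ∀ θ, circleMap 0 r θ ≠ 0 := fun θ => hw0 _ (hcirc θ)
  have hnorm : ∀ θ, ‖circleMap 0 r θ‖ = r := fun θ => by simp [abs_of_pos hr]
  refine intervalIntegral.hasSum_integral_of_dominated_convergence
    (fun n _ => (‖a‖ / r) ^ n / n ! * C) (fun n => ?_) (fun n => ?_) ?_ ?_ ?_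
  · have := continuous_circleMap 0 r
    refine Continuous.aestronglyMeasurable ((this.mul continuous_const).mul
      (Continuous.mul (Continuous.div ?_ this hcirc0) hgcirc))
    exact ((continuous_const.div this hcirc0).pow n).div_const _
  · refine ae_of_all _ fun θ _ => ?_
    have h1 := hC _ (hcirc θ)
    simp only [norm_mul, norm_div, norm_pow, hnorm, Complex.norm_I, mul_one, Complex.norm_natCast]
    have e : r * ((‖a‖ / r) ^ n / (n ! : ℝ) / r * ‖g (circleMap 0 r θ)‖) =
        (‖a‖ / r) ^ n / (n ! : ℝ) * ‖g (circleMap 0 r θ)‖ := by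
      field_simp
    rw [e]
    gcongr
  · exact ae_of_all _ fun θ _ => (Real.summable_pow_div_factorial _).mul_right C
  · exact intervalIntegrable_const
  · refine ae_of_all _ fun θ _ => ?_
    have := NormedSpace.expSeries_div_hasSum_exp (a / circleMap 0 r θ)
    rw [← Complex.exp_eq_exp_ℂ] at this
    exact ((this.div_const _).mul_right _).mul_left _

/-! ### Laplace transforms of circle integrals -/

/-- The (truncated) Laplace transform of `t ↦ ∮ e^{tz} h(z) dz`, for a circle in the open left
half-plane and `s` in the closed right half-plane. -/
theorem integral_Ioi_circleIntegral_exp {h : ℂ → ℂ} {c : ℂ} {r : ℝ} (hr : 0 ≤ r)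
    (hh : ContinuousOn h (sphere c r)) (hneg : ∀ z ∈ sphere c r, z.re < 0) {s : ℂ} (hs : 0 ≤ s.re)
    {τ : ℝ} (hτ : 0 ≤ τ) :
    IntegrableOn (fun t : ℝ => Complex.exp (-(t * s)) * ∮ z in C(c, r), Complex.exp (t * z) * h z)
      (Ioi τ) ∧
    ∫ t : ℝ in Ioi τ, Complex.exp (-(t * s)) * ∮ z in C(c, r), Complex.exp (t * z) * h z =
      ∮ z in C(c, r), Complex.exp (τ * (z - s)) / (s - z) * h z := by
  obtain ⟨δ, hδ, hδle⟩ : ∃ δ > 0, ∀ z ∈ sphere c r, z.re ≤ -δ := by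
    obtain ⟨w, hw, hmax⟩ := (isCompact_sphere c r).exists_isMaxOn
      (NormedSpace.sphere_nonempty.2 hr) Complex.continuous_re.continuousOn
    exact ⟨-w.re, by linarith [hneg w hw], fun z hz => by simpa using hmax hz⟩
  obtain ⟨C, hC⟩ := (isCompact_sphere c r).exists_bound_of_continuousOn hh
  have hC0 : 0 ≤ C := by
    obtain ⟨w, hw⟩ := (NormedSpace.sphere_nonempty (x := c)).2 hr
    exact (norm_nonneg _).trans (hC w hw)
  set G : ℝ → ℝ → ℂ := fun t θ => circleMap 0 r θ * Complex.I *
    (Complex.exp (t * (circleMap c r θ - s)) * h (circleMap c r θ)) with hG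
  have hGcont : Continuous (Function.uncurry G) := by
    have h1 := (continuous_circleMap 0 r).comp (continuous_snd (X := ℝ) (Y := ℝ))
    have h2 := (continuous_circleMap c r).comp (continuous_snd (X := ℝ) (Y := ℝ))
    have h3 : Continuous fun p : ℝ × ℝ => h (circleMap c r p.2) :=
      hh.comp_continuous h2 fun p => circleMap_mem_sphere c hr _
    refine (h1.mul continuous_const).mul (Continuous.mul (Continuous.cexp ?_) h3)
    exact (Complex.continuous_ofReal.comp continuous_fst).mul (h2.sub continuous_const)
  have hGint : Integrable (Function.uncurry G)
      ((volume.restrict (Ioi τ)).prod (volume.restrict (Ioc 0 (2 * Real.pi)))) := by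
    have hb : Integrable (fun p : ℝ × ℝ => r * C * Real.exp (-δ * p.1))
        ((volume.restrict (Ioi τ)).prod (volume.restrict (Ioc 0 (2 * Real.pi)))) :=
      (Integrable.comp_fst (integrableOn_exp_mul_Ioi (by linarith : -δ < 0) τ) _).const_mul (r * C)
    refine hb.mono' hGcont.aestronglyMeasurable ?_
    rw [Measure.prod_restrict]
    refine (ae_restrict_iff' (measurableSet_Ioi.prod measurableSet_Ioc)).2 (ae_of_all _ ?_)
    rintro ⟨t, θ⟩ ⟨ht, -⟩
    have ht' : 0 ≤ t := hτ.trans (le_of_lt ht)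
    have hz := circleMap_mem_sphere c hr θ
    simp only [Function.uncurry, hG, norm_mul, Complex.norm_exp, norm_circleMap_zero,
      Complex.norm_I, mul_one, abs_of_nonneg hr]
    rw [mul_assoc]
    refine mul_le_mul_of_nonneg_left ?_ hr
    rw [mul_comm]
    refine mul_le_mul (hC _ hz) (Real.exp_le_exp.2 ?_) (Real.exp_pos _).le hC0
    have := hδle _ hz
    simp only [Complex.mul_re, Complex.ofReal_re, Complex.ofReal_im, zero_mul, sub_zero,
      Complex.sub_re]
    nlinarith
  have hinner : ∀ t : ℝ, Complex.exp (-(t * s)) * (∮ z in C(c, r), Complex.exp (t * z) * h z) =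
      ∫ θ in Ioc 0 (2 * Real.pi), G t θ := by
    intro t
    rw [← circleIntegral.integral_const_mul, circleIntegral,
      intervalIntegral.integral_of_le (by positivity)]
    refine integral_congr_ae (ae_of_all _ fun θ => ?_)
    simp only [hG, deriv_circleMap, smul_eq_mul]
    rw [mul_sub, sub_eq_add_neg, Complex.exp_add]
    ring
  simp only [hinner]
  refine ⟨hGint.integral_prod_left, ?_⟩
  rw [integral_integral_swap hGint, circleIntegral,
      intervalIntegral.integral_of_le (by positivity)]
  refine integral_congr_ae (ae_of_all _ fun θ => ?_)
  simp only [hG, deriv_circleMap, smul_eq_mul]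
  have hz := hneg _ (circleMap_mem_sphere c hr θ)
  rw [integral_const_mul, integral_mul_const]
  simp only [mul_comm (_ : ℂ) (circleMap c r θ - s)]
  rw [integral_exp_mul_complex_Ioi (by simp; linarith), ← neg_sub (circleMap c r θ) s, div_neg,
    neg_div]

/-! ### Densities and characteristic functions -/

/-- An integrable function, not assumed nonnegative, whose Fourier transform is the characteristic
function of a finite measure is a density of that measure. -/
theorem measureReal_eq_setIntegral_of_charFun {ν : Measure ℝ} [IsFiniteMeasure ν] {g : ℝ → ℝ}
    (hg : Integrable g) (h : ∀ ξ : ℝ, charFun ν ξ = ∫ t : ℝ, Complex.exp (ξ * t * Complex.I) * g t)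
    {A : Set ℝ} (hA : MeasurableSet A) : ν.real A = ∫ t in A, g t := by
  have hpos : Integrable (fun t => g t ⊔ 0) := hg.pos_part
  have hnegp : Integrable (fun t => -g t ⊔ 0) := hg.neg_part
  set μp := (volume : Measure ℝ).withDensity fun t => ENNReal.ofReal (g t ⊔ 0) with hμp
  set μn := (volume : Measure ℝ).withDensity fun t => ENNReal.ofReal (-g t ⊔ 0) with hμn
  have : IsFiniteMeasure μp := isFiniteMeasure_withDensity_ofReal hpos.2
  have : IsFiniteMeasure μn := isFiniteMeasure_withDensity_ofReal hnegp.2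
  have hdens : ∀ (f : ℝ → ℝ), Integrable f → (∀ t, 0 ≤ f t) → ∀ ξ : ℝ,
      charFun (volume.withDensity fun t => ENNReal.ofReal (f t)) ξ =
        ∫ t : ℝ, Complex.exp (ξ * t * Complex.I) * f t := by
    intro f hf h0 ξ
    rw [charFun_apply_real, integral_withDensity_eq_integral_toReal_smul₀]
    · refine integral_congr_ae (ae_of_all _ fun t => ?_)
      simp [h0 t, mul_comm]
    · exact hf.1.aemeasurable.ennreal_ofReal
    · exact ae_of_all _ fun _ => ENNReal.ofReal_lt_top
  have hexp : ∀ (f : ℝ → ℝ), Integrable f → ∀ ξ : ℝ,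
      Integrable fun t : ℝ => Complex.exp (ξ * t * Complex.I) * f t := by
    intro f hf ξ
    refine hf.ofReal.bdd_mul (c := 1) ?_ (ae_of_all _ fun t => ?_)
    · exact Continuous.aestronglyMeasurable (by fun_prop)
    · rw [← Complex.ofReal_mul, Complex.norm_exp_ofReal_mul_I]
  -- moving the negative part to the other side gives two finite positive measures
  have heq : ν + μn = μp := by
    refine Measure.ext_of_charFun (funext fun ξ => ?_)
    have hadd : charFun (ν + μn) ξ = charFun ν ξ + charFun μn ξ := by
      simp only [charFun_apply_real]
      refine integral_add_measure ?_ ?_ <;>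
      · refine (integrable_const (1 : ℝ)).mono' (Continuous.aestronglyMeasurable (by fun_prop))
          (ae_of_all _ fun t => ?_)
        rw [← Complex.ofReal_mul, Complex.norm_exp_ofReal_mul_I]
    rw [hadd, h, hμp, hμn, hdens _ hnegp (fun _ => le_sup_right), hdens _ hpos fun _ => le_sup_right,
      ← integral_add (hexp _ hg ξ) (hexp _ hnegp ξ)]
    refine integral_congr_ae (ae_of_all _ fun t => ?_)
    simp only
    rw [← mul_add, ← Complex.ofReal_add]
    congr 2
    rcases le_total (g t) 0 with h | h
    · simp [h]
    · simp [h]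
  have hreal : ∀ (f : ℝ → ℝ), Integrable f → (∀ t, 0 ≤ f t) →
      (volume.withDensity fun t => ENNReal.ofReal (f t)).real A = ∫ t in A, f t := by
    intro f hf h0
    rw [measureReal_def, withDensity_apply _ hA,
      integral_eq_lintegral_of_nonneg_ae (ae_of_all _ h0) hf.1.restrict]
  have h1 : ν.real A + μn.real A = μp.real A := by
    rw [← heq, measureReal_add_apply]
  rw [hμp, hμn, hreal _ hnegp (fun _ => le_sup_right), hreal _ hpos fun _ => le_sup_right] at h1
  rw [eq_sub_of_add_eq h1, ← integral_sub hpos.integrableOn hnegp.integrableOn]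
  refine integral_congr_ae (ae_of_all _ fun t => ?_)
  rcases le_total (g t) 0 with h | h
  · simp [h]
  · simp [h]

/-- The complex-valued version of `measureReal_eq_setIntegral_of_charFun`: real-valuedness of the
density is a consequence. -/
theorem measureReal_eq_setIntegral_complex_of_charFun {ν : Measure ℝ} [IsFiniteMeasure ν]
    {g : ℝ → ℂ} (hg : Integrable g)
    (h : ∀ ξ : ℝ, charFun ν ξ = ∫ t : ℝ, Complex.exp (ξ * t * Complex.I) * g t)
    {A : Set ℝ} (hA : MeasurableSet A) : (ν.real A : ℂ) = ∫ t in A, g t := by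
  have hexp : ∀ (f : ℝ → ℂ), Integrable f → ∀ ξ : ℝ,
      Integrable fun t : ℝ => Complex.exp (ξ * t * Complex.I) * f t := by
    intro f hf ξ
    refine hf.bdd_mul (c := 1) ?_ (ae_of_all _ fun t => ?_)
    · exact Continuous.aestronglyMeasurable (by fun_prop)
    · rw [← Complex.ofReal_mul, Complex.norm_exp_ofReal_mul_I]
  -- by Hermitian symmetry of `charFun`, the conjugate of `g` has the same Fourier transform
  have hconj : ∀ ξ : ℝ, charFun ν ξ =
      ∫ t : ℝ, Complex.exp (ξ * t * Complex.I) * (starRingEnd ℂ) (g t) := by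
    intro ξ
    have := h (-ξ)
    rw [charFun_neg] at this
    rw [← Complex.conj_conj (charFun ν ξ), this, ← integral_conj]
    refine integral_congr_ae (ae_of_all _ fun t => ?_)
    simp [← Complex.exp_conj]
  have hgc : Integrable fun t => (starRingEnd ℂ) (g t) :=
    (Complex.conjCLE.toContinuousLinearMap.integrable_comp hg :)
  have hre : ∀ ξ : ℝ, charFun ν ξ = ∫ t : ℝ, Complex.exp (ξ * t * Complex.I) * ((g t).re : ℂ) := by
    intro ξ
    have e : charFun ν ξ = (charFun ν ξ + charFun ν ξ) / 2 := by ring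
    rw [e]
    nth_rewrite 1 [h ξ]
    rw [hconj ξ, ← integral_add (hexp _ hg ξ) (hexp _ hgc ξ), ← integral_div]
    refine integral_congr_ae (ae_of_all _ fun t => ?_)
    simp only
    rw [Complex.re_eq_add_conj]
    ring
  have him : ∀ ξ : ℝ, charFun (0 : Measure ℝ) ξ =
      ∫ t : ℝ, Complex.exp (ξ * t * Complex.I) * ((g t).im : ℂ) := by
    intro ξ
    have e : charFun (0 : Measure ℝ) ξ = (charFun ν ξ - charFun ν ξ) / (2 * Complex.I) := by simp
    rw [e]
    nth_rewrite 1 [h ξ]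
    rw [hconj ξ, ← integral_sub (hexp _ hg ξ) (hexp _ hgc ξ), ← integral_div]
    refine integral_congr_ae (ae_of_all _ fun t => ?_)
    simp only
    rw [Complex.im_eq_sub_conj]
    ring
  have h1 := measureReal_eq_setIntegral_of_charFun hg.re hre hA
  have h2 := measureReal_eq_setIntegral_of_charFun hg.im him hA
  rw [← integral_re_add_im hg.integrableOn]
  simp only [RCLike.re_to_complex, RCLike.im_to_complex] at h1 h2 ⊢
  rw [← h1, ← h2]
  simp

/-! ### The tail of a sum of noncentral chi-square variables -/

/-- The function `s ↦ E exp (-s |X|²)` for a complex Gaussian variable `X` of variance `l` whose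
mean has squared modulus `l * q`, continued to complex `s`. Note the sign of `s`, opposite to that
of a moment generating function. The only singularity is at `-1 / l`. -/
noncomputable def noncentralMGF (l q : ℝ) (s : ℂ) : ℂ :=
  Complex.exp (-(l * s / (1 + l * s) * q)) / (1 + l * s)

theorem one_add_mul_ne_zero {l : ℝ} (hl : 0 < l) {s : ℂ} (hs : s ≠ -1 / (l : ℂ)) :
    1 + (l : ℂ) * s ≠ 0 := by
  intro h
  have : (l : ℂ) ≠ 0 := mod_cast hl.ne'
  apply hs
  field_simp
  linear_combination h

theorem differentiableOn_noncentralMGF {l : ℝ} (hl : 0 < l) (q : ℝ) :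
    DifferentiableOn ℂ (noncentralMGF l q) {-1 / (l : ℂ)}ᶜ := by
  have h : ∀ s ∈ ({-1 / (l : ℂ)}ᶜ : Set ℂ), 1 + (l : ℂ) * s ≠ 0 :=
    fun s hs => one_add_mul_ne_zero hl hs
  have h1 : DifferentiableOn ℂ (fun s : ℂ => 1 + (l : ℂ) * s) {-1 / (l : ℂ)}ᶜ := by fun_prop
  have h2 : DifferentiableOn ℂ (fun s : ℂ => (l : ℂ) * s) {-1 / (l : ℂ)}ᶜ := by fun_prop
  exact (((h2.div h1 h).mul_const _).neg.cexp).div h1 h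

theorem tendsto_noncentralMGF {l : ℝ} (hl : 0 < l) (q : ℝ) :
    Tendsto (noncentralMGF l q) (Bornology.cobounded ℂ) (𝓝 0) := by
  have hl' : (l : ℂ) ≠ 0 := mod_cast hl.ne'
  have h1 : Tendsto (fun s : ℂ => 1 + (l : ℂ) * s) (Bornology.cobounded ℂ)
      (Bornology.cobounded ℂ) :=
    (tendsto_const_add_cobounded 1).comp (tendsto_mul_left_cobounded hl')
  have hinv : Tendsto (fun s : ℂ => (1 + (l : ℂ) * s)⁻¹) (Bornology.cobounded ℂ) (𝓝 0) :=
    tendsto_inv₀_cobounded.comp h1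
  have h2 : Tendsto (fun s : ℂ => Complex.exp (-((1 - (1 + (l : ℂ) * s)⁻¹) * q)) *
      (1 + (l : ℂ) * s)⁻¹) (Bornology.cobounded ℂ) (𝓝 (Complex.exp (-((1 - 0) * q)) * 0)) :=
    (Complex.continuous_exp.tendsto _ |>.comp
      ((hinv.const_sub 1).mul_const (q : ℂ)).neg).mul hinv
  rw [mul_zero] at h2
  refine h2.congr' ?_
  have h3 : ∀ᶠ s : ℂ in Bornology.cobounded ℂ, 1 + (l : ℂ) * s ≠ 0 :=
    h1.eventually (Bornology.eventually_ne_cobounded 0)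
  filter_upwards [h3] with s hs
  rw [noncentralMGF, ← div_eq_mul_inv]
  congr 4
  field_simp
  ring

/-- The inversion integrand near `-1 / lam i`, in the local coordinate `w`: the `i`-th factor gives
`exp (a / w) / w`, and everything else is collected in the function `gFun`, analytic at `0`. -/
theorem prod_noncentralMGF_eq {K : ℕ} {lam : Fin K → ℝ} (hlam : ∀ i, 0 < lam i)
    (χ : Fin K → ℂ) (τ : ℝ) (i : Fin K) {w : ℂ} (hw : w ≠ 0) :
    Complex.exp (τ * (-1 / (lam i : ℂ) + w)) / (0 - (-1 / (lam i : ℂ) + w)) *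
        ∏ p, noncentralMGF (lam p) (‖χ p‖ ^ 2) (-1 / (lam i : ℂ) + w) =
      -((Real.exp (-(‖χ i‖ ^ 2 + τ / lam i)) / lam i : ℝ) : ℂ) *
        (Complex.exp (((‖χ i‖ ^ 2 / lam i : ℝ) : ℂ) / w) / w * gFun lam χ τ i w) := by
  have hl : (lam i : ℂ) ≠ 0 := mod_cast (hlam i).ne'
  have hz : -1 / (lam i : ℂ) + w = w - 1 / lam i := by ring
  have hi : noncentralMGF (lam i) (‖χ i‖ ^ 2) (w - 1 / lam i) =
      Complex.exp (-(‖χ i‖ : ℂ) ^ 2) *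
        Complex.exp (((‖χ i‖ ^ 2 / lam i : ℝ) : ℂ) / w) / (lam i * w) := by
    have e : 1 + (lam i : ℂ) * (w - 1 / lam i) = lam i * w := by field_simp; ring
    rw [noncentralMGF, e, ← Complex.exp_add]
    congr 2
    push_cast
    field_simp
    ring
  have hrest : ∏ p ∈ Finset.univ.erase i, noncentralMGF (lam p) (‖χ p‖ ^ 2) (w - 1 / lam i) =
      Complex.exp (-∑ p ∈ Finset.univ.erase i,
        lam p * (w - 1 / lam i) / (1 + lam p * (w - 1 / lam i)) * (‖χ p‖ : ℂ) ^ 2) /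
      ∏ p ∈ Finset.univ.erase i, (1 + lam p * (w - 1 / lam i)) := by
    simp only [noncentralMGF]
    rw [Finset.prod_div_distrib, ← Complex.exp_sum, Finset.sum_neg_distrib]
    push_cast
    rfl
  have hexp : Complex.exp (τ * (w - 1 / lam i)) =
      Complex.exp (τ * w) * Complex.exp (-(τ / lam i : ℂ)) := by
    rw [← Complex.exp_add]
    congr 1
    ring
  have hconst : ((Real.exp (-(‖χ i‖ ^ 2 + τ / lam i)) / lam i : ℝ) : ℂ) =
      Complex.exp (-(‖χ i‖ : ℂ) ^ 2) * Complex.exp (-(τ / lam i : ℂ)) / lam i := by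
    rw [← Complex.exp_add]
    push_cast
    congr 2
    ring
  rw [hz, ← Finset.mul_prod_erase _ _ (Finset.mem_univ i), hi, hrest, hexp, hconst, gFun,
    zero_sub, div_neg]
  ring

theorem differentiableOn_gFun {K : ℕ} {lam : Fin K → ℝ} (hlam : ∀ i, 0 < lam i)
    (χ : Fin K → ℂ) (τ : ℝ) (i : Fin K) {U : Set ℂ} (h0 : ∀ w ∈ U, w - 1 / (lam i : ℂ) ≠ 0)
    (h : ∀ w ∈ U, ∀ p ≠ i, -1 / (lam i : ℂ) + w ≠ -1 / (lam p : ℂ)) :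
    DifferentiableOn ℂ (gFun lam χ τ i) U := by
  have hden : ∀ w ∈ U, ∀ p ∈ Finset.univ.erase i, 1 + (lam p : ℂ) * (w - 1 / lam i) ≠ 0 := by
    intro w hw p hp
    refine one_add_mul_ne_zero (hlam p) fun e => h w hw p (Finset.ne_of_mem_erase hp) ?_
    rw [← e]
    ring
  refine DifferentiableOn.mul (DifferentiableOn.div (by fun_prop) (by fun_prop) h0)
    (DifferentiableOn.div (DifferentiableOn.cexp (DifferentiableOn.neg
      (DifferentiableOn.fun_sum fun p hp => ?_))) (by fun_prop) fun w hw => ?_)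
  · exact DifferentiableOn.mul_const (DifferentiableOn.div (by fun_prop) (by fun_prop)
      fun w hw => hden w hw p hp) _
  · exact Finset.prod_ne_zero_iff.2 fun p hp => hden w hw p hp

theorem circleIntegral_eq_circleIntegral_zero (f : ℂ → ℂ) (c : ℂ) (r : ℝ) :
    (∮ z in C(c, r), f z) = ∮ w in C(0, r), f (c + w) := by
  simp [circleIntegral, circleMap]

/-- A common radius for pairwise disjoint discs around the singularities `-1 / lam i`, all inside
the open left half-plane. -/
theorem exists_pos_radius_disjoint {K : ℕ} {lam : Fin K → ℝ} (hlam : ∀ i, 0 < lam i)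
    (hinj : Function.Injective lam) : ∃ r > 0, (∀ i, r < 1 / lam i) ∧
      Pairwise fun i j => 2 * r < dist (-1 / (lam i : ℂ)) (-1 / (lam j : ℂ)) := by
  have h1 : ∀ᶠ r : ℝ in 𝓝[>] 0, ∀ i, r < 1 / lam i :=
    eventually_all.2 fun i => nhdsWithin_le_nhds (eventually_lt_nhds (by have := hlam i; positivity))
  have h2 : ∀ᶠ r : ℝ in 𝓝[>] 0, ∀ i j, i ≠ j →
      2 * r < dist (-1 / (lam i : ℂ)) (-1 / (lam j : ℂ)) := by
    refine eventually_all.2 fun i => eventually_all.2 fun j => ?_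
    by_cases hij : i = j
    · exact Eventually.of_forall fun _ h => absurd hij h
    · have hd : 0 < dist (-1 / (lam i : ℂ)) (-1 / (lam j : ℂ)) := by
        refine dist_pos.2 fun e => hij (hinj ?_)
        simpa [neg_div] using e
      filter_upwards [nhdsWithin_le_nhds (eventually_lt_nhds (half_pos hd))] with r hr _
      linarith
  obtain ⟨r, h1, h2, h3⟩ := (h1.and (h2.and self_mem_nhdsWithin)).exists
  exact ⟨r, h3, h1, fun i j => h2 i j⟩

/-- The tail of a measure whose characteristic function is that of a sum of independent noncentral
chi-square variables with distinct scales `lam i`. -/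
theorem measureReal_Ici_of_charFun_eq_prod {K : ℕ} [NeZero K] {lam : Fin K → ℝ}
    (hlam : ∀ i, 0 < lam i) (hinj : Function.Injective lam) (χ : Fin K → ℂ) {ν : Measure ℝ}
    [IsFiniteMeasure ν]
    (hν : ∀ ξ : ℝ, charFun ν ξ = ∏ i, noncentralMGF (lam i) (‖χ i‖ ^ 2) (-(ξ * Complex.I)))
    {τ : ℝ} (hτ : 0 ≤ τ) :
    (∀ i, Summable fun n : ℕ =>
      (1 / (n ! : ℂ)) ^ 2 * (((‖χ i‖ ^ 2 / lam i) ^ n : ℝ) : ℂ)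
        * iteratedDeriv n (gFun lam χ τ i) 0) ∧
    (ν.real (Ici τ) : ℂ) =
      -∑ i, ((Real.exp (-(‖χ i‖ ^ 2 + τ / lam i)) / lam i : ℝ) : ℂ) *
        ∑' n : ℕ, (1 / (n ! : ℂ)) ^ 2 * (((‖χ i‖ ^ 2 / lam i) ^ n : ℝ) : ℂ)
          * iteratedDeriv n (gFun lam χ τ i) 0 := by
  obtain ⟨r, hr, hrlam, hdisj⟩ := exists_pos_radius_disjoint hlam hinj
  set c : Fin K → ℂ := fun i => -1 / (lam i : ℂ) with hc
  set M : ℂ → ℂ := fun z => ∏ p, noncentralMGF (lam p) (‖χ p‖ ^ 2) z with hM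
  have hcre : ∀ i, (c i).re = -(1 / lam i) := by
    intro i
    have : c i = ((-(1 / lam i) : ℝ) : ℂ) := by simp only [hc]; push_cast; ring
    rw [this, Complex.ofReal_re]
  have hneg : ∀ i, ∀ z ∈ sphere (c i) r, z.re < 0 := by
    intro i z hz
    have h1 := Complex.abs_re_le_norm (z - c i)
    rw [← dist_eq_norm, mem_sphere.1 hz, Complex.sub_re, hcre] at h1
    have := (abs_le.1 h1).2
    have := hrlam i
    linarith
  have hout : ∀ s : ℂ, 0 ≤ s.re → ∀ i, r < dist s (c i) := by
    intro s hs i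
    have h1 := Complex.abs_re_le_norm (s - c i)
    rw [← dist_eq_norm, Complex.sub_re, hcre] at h1
    have := le_abs_self (s.re - -(1 / lam i))
    have := hrlam i
    linarith
  have hMcont : ∀ i, ContinuousOn M (sphere (c i) r) := by
    refine fun i => continuousOn_finsetProd _ fun p _ =>
      (differentiableOn_noncentralMGF (hlam p) _).continuousOn.mono ?_
    rintro z hz h
    rw [mem_singleton_iff] at h
    change z = c p at h
    rcases eq_or_ne i p with rfl | hip
    · rw [h] at hz
      simp at hz
      exact hr.ne hz
    · have := hdisj hip
      rw [mem_sphere, h, dist_comm] at hz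
      linarith
  have hexpand : ∀ s : ℂ, 0 ≤ s.re → M s =
      ∑ i, (2 * Real.pi * Complex.I)⁻¹ * ∮ z in C(c i, r), M z / (s - z) := fun s hs =>
    prod_eq_sum_circleIntegral hr (fun i => differentiableOn_noncentralMGF (hlam i) _)
      (fun i => tendsto_noncentralMGF (hlam i) _) hdisj Finset.univ_nonempty s
      fun i _ => hout s hs i
  have hlap := fun (i : Fin K) {s : ℂ} (hs : 0 ≤ s.re) {τ : ℝ} (hτ : 0 ≤ τ) =>
    integral_Ioi_circleIntegral_exp hr.le (hMcont i) (hneg i) hs hτ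
  -- the density of `ν`, obtained by Laplace inversion around each singularity
  set f : ℝ → ℂ := fun t =>
    ∑ i, (2 * Real.pi * Complex.I)⁻¹ * ∮ z in C(c i, r), Complex.exp (t * z) * M z with hf
  have hfs : ∀ {s : ℂ}, 0 ≤ s.re → ∀ {τ : ℝ}, 0 ≤ τ →
      IntegrableOn (fun t : ℝ => Complex.exp (-(t * s)) * f t) (Ioi τ) ∧
      ∫ t in Ioi τ, Complex.exp (-(t * s)) * f t = ∑ i, (2 * Real.pi * Complex.I)⁻¹ *
        ∮ z in C(c i, r), Complex.exp (τ * (z - s)) / (s - z) * M z := by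
    intro s hs τ hτ
    have e : ∀ t : ℝ, Complex.exp (-(t * s)) * f t = ∑ i, (2 * Real.pi * Complex.I)⁻¹ *
        (Complex.exp (-(t * s)) * ∮ z in C(c i, r), Complex.exp (t * z) * M z) := by
      intro t
      rw [hf, Finset.mul_sum]
      exact Finset.sum_congr rfl fun i _ => by ring
    simp only [e]
    refine ⟨integrable_finsetSum _ fun i _ => (hlap i hs hτ).1.const_mul _, ?_⟩
    rw [integral_finsetSum _ fun i _ => (hlap i hs hτ).1.const_mul _]
    exact Finset.sum_congr rfl fun i _ => by rw [integral_const_mul, (hlap i hs hτ).2]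
  have hf0 : ∀ {τ : ℝ}, 0 ≤ τ → IntegrableOn f (Ioi τ) ∧
      ∫ t in Ioi τ, f t = ∑ i, (2 * Real.pi * Complex.I)⁻¹ *
        ∮ z in C(c i, r), Complex.exp (τ * z) / (0 - z) * M z := by
    intro τ hτ
    simpa using hfs (s := 0) le_rfl hτ
  have hchar : ∀ ξ : ℝ, charFun ν ξ =
      ∫ t : ℝ, Complex.exp (ξ * t * Complex.I) * (Ioi 0).indicator f t := by
    intro ξ
    have hs : 0 ≤ (-(ξ * Complex.I) : ℂ).re := by simp
    have e : (fun t : ℝ => Complex.exp (ξ * t * Complex.I) * (Ioi 0).indicator f t) =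
        (Ioi 0).indicator fun t : ℝ => Complex.exp (-(t * (-(ξ * Complex.I)))) * f t := by
      ext t
      by_cases ht : t ∈ Ioi (0 : ℝ)
      · rw [indicator_of_mem ht, indicator_of_mem ht]
        congr 2
        ring
      · rw [indicator_of_notMem ht, indicator_of_notMem ht, mul_zero]
    rw [e, integral_indicator measurableSet_Ioi, (hfs hs le_rfl).2, hν]
    refine (hexpand _ hs).trans (Finset.sum_congr rfl fun i _ => ?_)
    congr 1
    refine circleIntegral.integral_congr hr.le fun z _ => ?_
    simp
    ring
  have hprob : (ν.real (Ici τ) : ℂ) = ∑ i, (2 * Real.pi * Complex.I)⁻¹ *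
        ∮ z in C(c i, r), Complex.exp (τ * z) / (0 - z) * M z := by
    rw [measureReal_eq_setIntegral_complex_of_charFun
      ((integrable_indicator_iff measurableSet_Ioi).2 (hf0 le_rfl).1) hchar measurableSet_Ici,
      integral_Ici_eq_integral_Ioi, ← (hf0 hτ).2]
    refine setIntegral_congr_fun measurableSet_Ioi fun t ht => ?_
    exact indicator_of_mem (hτ.trans_lt ht) f
  have hball : ∀ i p, p ≠ i → ∀ w ∈ closedBall (0 : ℂ) r, c i + w ≠ c p := by
    intro i p hp w hw h
    have h1 := hdisj hp
    change 2 * r < dist (c p) (c i) at h1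
    rw [← h, dist_eq_norm, add_sub_cancel_left] at h1
    rw [mem_closedBall_zero_iff] at hw
    linarith
  have hsum := fun i => hasSum_circleIntegral_exp_div hr (differentiableOn_gFun hlam χ τ i
    (U := closedBall 0 r) (fun w hw h => by
      rw [sub_eq_zero] at h
      rw [mem_closedBall_zero_iff, h] at hw
      have h1 := hrlam i
      have h2 : ‖(1 / (lam i : ℂ))‖ = 1 / lam i := by simp [abs_of_pos (hlam i)]
      linarith) fun w hw p hp => hball i p hp w hw) ((‖χ i‖ ^ 2 / lam i : ℝ) : ℂ)
  simp only [← Complex.ofReal_pow] at hsum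
  refine ⟨fun i => (hsum i).summable, ?_⟩
  rw [hprob, ← Finset.sum_neg_distrib]
  refine Finset.sum_congr rfl fun i _ => ?_
  rw [(hsum i).tsum_eq, mul_left_comm, ← mul_neg, ← neg_mul,
    ← circleIntegral.integral_const_mul (-_), circleIntegral_eq_circleIntegral_zero]
  congr 1
  refine circleIntegral.integral_congr hr.le fun w hw => ?_
  exact prod_noncentralMGF_eq hlam χ τ i (ne_of_mem_sphere hw hr.ne')

/-! ### Complex Gaussian variables -/

instance isProbabilityMeasure_complexGaussian (v : ℝ≥0) :
    IsProbabilityMeasure (complexGaussian v) :=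
  Measure.isProbabilityMeasure_map (by fun_prop)

theorem integral_complexGaussian (v : ℝ≥0) {f : ℂ → ℂ} (hf : Continuous f) :
    ∫ z, f z ∂complexGaussian v = ∫ p : ℝ × ℝ, f ((p.1 : ℂ) + p.2 * Complex.I)
      ∂(gaussianReal 0 (v / 2)).prod (gaussianReal 0 (v / 2)) :=
  integral_map (by fun_prop) hf.aestronglyMeasurable

theorem charFun_complexGaussian (v : ℝ≥0) (t : ℂ) :
    charFun (complexGaussian v) t = Complex.exp (-(v * ‖t‖ ^ 2 / 4 : ℝ)) := by
  rw [charFun_apply, integral_complexGaussian v (by fun_prop)]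
  have e : ∀ p : ℝ × ℝ, Complex.exp ((inner ℝ ((p.1 : ℂ) + p.2 * Complex.I) t : ℝ) * Complex.I) =
      Complex.exp (t.re * p.1 * Complex.I) * Complex.exp (t.im * p.2 * Complex.I) := by
    intro p
    rw [← Complex.exp_add, Complex.inner]
    congr 1
    simp
    ring
  simp only [e]
  rw [integral_prod_mul (fun x : ℝ => Complex.exp (t.re * x * Complex.I))
    (fun y : ℝ => Complex.exp (t.im * y * Complex.I)), ← charFun_apply_real, ← charFun_apply_real,
    charFun_gaussianReal, charFun_gaussianReal, ← Complex.exp_add, Complex.sq_norm,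
    Complex.normSq_apply]
  congr 1
  push_cast
  ring

theorem hasLaw_const_mul_complexGaussian {Ω : Type*} [MeasurableSpace Ω] {P : Measure Ω}
    {X : Ω → ℂ} {v : ℝ≥0} (hX : HasLaw X (complexGaussian v) P) (a : ℂ) :
    HasLaw (fun ω => a * X ω) (complexGaussian (v * ‖a‖₊ ^ 2)) P where
  aemeasurable := hX.aemeasurable.const_mul a
  map_eq := by
    have : IsProbabilityMeasure P := hX.isProbabilityMeasure
    have := Measure.isProbabilityMeasure_map (hX.aemeasurable.const_mul a)
    refine Measure.ext_of_charFun (funext fun t => ?_)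
    have h1 : charFun (P.map fun ω => a * X ω) t =
        charFun (complexGaussian v) ((starRingEnd ℂ) a * t) := by
      rw [← hX.map_eq, charFun_apply, charFun_apply,
        integral_map (hX.aemeasurable.const_mul a) (Continuous.aestronglyMeasurable (by fun_prop)),
        integral_map hX.aemeasurable (Continuous.aestronglyMeasurable (by fun_prop))]
      refine integral_congr_ae (ae_of_all _ fun ω => ?_)
      simp only [Complex.inner, map_mul]
      congr 4
      ring
    rw [h1, charFun_complexGaussian, charFun_complexGaussian, norm_mul, RCLike.norm_conj]
    congr 1
    push_cast
    ring

theorem hasLaw_sum_complexGaussian {Ω ι : Type*} [MeasurableSpace Ω] [Fintype ι] {P : Measure Ω}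
    [IsProbabilityMeasure P]
    {X : ι → Ω → ℂ} {v : ι → ℝ≥0} (hX : ∀ i, HasLaw (X i) (complexGaussian (v i)) P)
    (hind : iIndepFun X P) :
    HasLaw (fun ω => ∑ i, X i ω) (complexGaussian (∑ i, v i)) P where
  aemeasurable := Finset.aemeasurable_fun_sum _ fun i _ => (hX i).aemeasurable
  map_eq := by
    have := Measure.isProbabilityMeasure_map (μ := P)
      (Finset.aemeasurable_fun_sum Finset.univ fun i _ => (hX i).aemeasurable)
    refine Measure.ext_of_charFun (funext fun t => ?_)
    rw [hind.charFun_map_fun_sum_eq_prod fun i => (hX i).aemeasurable, Finset.prod_apply]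
    simp only [(hX _).map_eq, charFun_complexGaussian]
    rw [← Complex.exp_sum]
    congr 1
    push_cast
    rw [Finset.sum_neg_distrib, Finset.sum_mul, Finset.sum_div]

theorem memLp_two_id_complexGaussian (v : ℝ≥0) :
    MemLp (fun z : ℂ => z) 2 (complexGaussian v) := by
  refine (memLp_map_measure_iff (by fun_prop) (by fun_prop)).2 ?_
  have h : MemLp (fun x : ℝ => (x : ℂ)) 2 (gaussianReal 0 (v / 2)) :=
    (memLp_id_gaussianReal 2).ofReal
  exact (h.comp_fst _).add ((h.comp_snd _).mul_const _)

theorem integral_id_complexGaussian (v : ℝ≥0) : ∫ z, z ∂complexGaussian v = 0 := by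
  rw [integral_complexGaussian v (by fun_prop)]
  have h : Integrable (fun x : ℝ => (x : ℂ)) (gaussianReal 0 (v / 2)) :=
    ((memLp_id_gaussianReal 1).ofReal (K := ℂ)).integrable (by norm_num)
  rw [integral_add (h.comp_fst _) ((h.comp_snd _).mul_const _), integral_mul_const,
    integral_fun_fst (fun x : ℝ => (x : ℂ)), integral_fun_snd (fun x : ℝ => (x : ℂ)),
    integral_complex_ofReal, integral_id_gaussianReal]
  simp

theorem integral_mul_star_complexGaussian (v : ℝ≥0) :
    ∫ z, z * star z ∂complexGaussian v = v := by
  rw [integral_complexGaussian v (by fun_prop)]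
  have hsq : ∫ x : ℝ, ((x : ℂ)) ^ 2 ∂gaussianReal 0 (v / 2) = v / 2 := by
    have h := variance_of_integral_eq_zero (μ := gaussianReal 0 (v / 2)) (X := id)
      aemeasurable_id integral_id_gaussianReal
    rw [variance_id_gaussianReal] at h
    simp only [← Complex.ofReal_pow]
    rw [integral_complex_ofReal]
    simp only [id] at h
    rw [← h]
    simp
  have h : Integrable (fun x : ℝ => (x : ℂ) ^ 2) (gaussianReal 0 (v / 2)) := by
    have := (memLp_id_gaussianReal (μ := 0) (v := v / 2) 2).integrable_sq.ofReal (𝕜 := ℂ)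
    simpa using this
  have e : ∀ p : ℝ × ℝ, ((p.1 : ℂ) + p.2 * Complex.I) * star ((p.1 : ℂ) + p.2 * Complex.I) =
      (p.1 : ℂ) ^ 2 + (p.2 : ℂ) ^ 2 := by
    intro p
    simp
    linear_combination -(p.2 : ℂ) ^ 2 * Complex.I_sq
  simp only [e]
  rw [integral_add (h.comp_fst _) (h.comp_snd _), integral_fun_fst (fun x : ℝ => (x : ℂ) ^ 2),
    integral_fun_snd (fun x : ℝ => (x : ℂ) ^ 2), hsq]
  simp

theorem integral_exp_sq_gaussianReal {w : ℝ≥0} (hw : w ≠ 0) (a ξ : ℝ) :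
    ∫ x, Complex.exp (ξ * ((a + x : ℝ) : ℂ) ^ 2 * Complex.I) ∂gaussianReal 0 w =
      ((√(2 * Real.pi * w))⁻¹ : ℝ) *
        ((Real.pi / (1 / (2 * w) - ξ * Complex.I)) ^ (1 / 2 : ℂ) *
          Complex.exp (ξ * Complex.I * a ^ 2 / (1 - 2 * w * ξ * Complex.I))) := by
  have hw' : (0 : ℝ) < w := by positivity
  rw [integral_gaussianReal_eq_integral_smul hw]
  have e : ∀ x : ℝ, gaussianPDFReal 0 w x • Complex.exp (ξ * ((a + x : ℝ) : ℂ) ^ 2 * Complex.I) =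
      ((√(2 * Real.pi * w))⁻¹ : ℝ) * Complex.exp ((ξ * Complex.I - 1 / (2 * w)) * x ^ 2 +
        (2 * a * ξ * Complex.I) * x + ξ * a ^ 2 * Complex.I) := by
    intro x
    rw [gaussianPDFReal, Complex.real_smul, Complex.ofReal_mul, mul_assoc, Complex.ofReal_exp,
      ← Complex.exp_add]
    congr 2
    push_cast
    ring
  have hre : (ξ * Complex.I - 1 / (2 * w) : ℂ).re = -(1 / (2 * w)) := by
    have : (ξ * Complex.I - 1 / (2 * w) : ℂ) = ((-(1 / (2 * w)) : ℝ) : ℂ) + ξ * Complex.I := by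
      push_cast
      ring
    rw [this]
    simp
  have hb0 : (1 - 2 * w * ξ * Complex.I : ℂ) ≠ 0 := by
    intro h
    simpa using congrArg Complex.re h
  have hw0 : (w : ℂ) ≠ 0 := mod_cast hw
  simp only [e]
  rw [integral_const_mul, integral_cexp_quadratic (by rw [hre]; simpa using hw'), neg_sub]
  congr 3
  have hb : (ξ * Complex.I - 1 / (2 * w) : ℂ) = -(1 - 2 * w * ξ * Complex.I) / (2 * w) := by
    field_simp
    ring
  rw [hb]
  generalize hD : (1 - 2 * w * ξ * Complex.I : ℂ) = D at hb0 ⊢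
  rw [eq_div_iff hb0, sub_mul]
  have h4 : (2 * a * ξ * Complex.I) ^ 2 / (4 * (-D / (2 * w))) * D =
      -(2 * w * (a * ξ * Complex.I) ^ 2) := by
    field_simp
    ring
  rw [h4, ← hD]
  ring

/-- The characteristic function of the squared modulus of a noncentral complex Gaussian. -/
theorem integral_exp_normSq_complexGaussian {v : ℝ≥0} (hv : v ≠ 0) (m : ℂ) {q : ℝ}
    (hm : ‖m‖ ^ 2 = v * q) (ξ : ℝ) :
    ∫ z, Complex.exp (ξ * (‖m + z‖ ^ 2 : ℝ) * Complex.I) ∂complexGaussian v =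
      noncentralMGF v q (-(ξ * Complex.I)) := by
  rw [integral_complexGaussian v (by fun_prop)]
  have e : ∀ p : ℝ × ℝ,
      Complex.exp (ξ * (‖m + ((p.1 : ℂ) + p.2 * Complex.I)‖ ^ 2 : ℝ) * Complex.I) =
        Complex.exp (ξ * ((m.re + p.1 : ℝ) : ℂ) ^ 2 * Complex.I) *
          Complex.exp (ξ * ((m.im + p.2 : ℝ) : ℂ) ^ 2 * Complex.I) := by
    intro p
    rw [← Complex.exp_add, Complex.sq_norm, Complex.normSq_apply]
    congr 1
    simp
    ring
  simp only [e]
  have hv2 : v / 2 ≠ 0 := by positivity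
  have hv0 : (v : ℂ) ≠ 0 := mod_cast hv
  have hvr : (0 : ℝ) < v := by positivity
  rw [integral_prod_mul (fun x : ℝ => Complex.exp (ξ * ((m.re + x : ℝ) : ℂ) ^ 2 * Complex.I))
    (fun x : ℝ => Complex.exp (ξ * ((m.im + x : ℝ) : ℂ) ^ 2 * Complex.I)),
    integral_exp_sq_gaussianReal hv2, integral_exp_sq_gaussianReal hv2]
  have hb0 : (1 - v * ξ * Complex.I : ℂ) ≠ 0 := by
    intro h
    simpa using congrArg Complex.re h
  have h2v : 2 * ((v / 2 : ℝ≥0) : ℂ) = v := by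
    push_cast
    ring
  have h2v' : 2 * Real.pi * ((v / 2 : ℝ≥0) : ℝ) = Real.pi * v := by
    push_cast
    ring
  rw [h2v, h2v']
  set B : ℂ := Real.pi / (1 / v - ξ * Complex.I) with hB
  have hBeq : B = Real.pi * v / (1 - v * ξ * Complex.I) := by
    rw [hB]
    have : (1 / v - ξ * Complex.I : ℂ) = (1 - v * ξ * Complex.I) / v := by field_simp
    rw [this]
    field_simp
  have hpi : (Real.pi : ℂ) ≠ 0 := mod_cast Real.pi_ne_zero
  have hB0 : B ≠ 0 := by
    rw [hBeq]
    exact div_ne_zero (mul_ne_zero hpi hv0) hb0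
  have hBB : B ^ (1 / 2 : ℂ) * B ^ (1 / 2 : ℂ) = B := by
    rw [← Complex.cpow_add _ _ hB0]
    norm_num
  have hs : (((√(Real.pi * v))⁻¹ : ℝ) : ℂ) * (((√(Real.pi * v))⁻¹ : ℝ) : ℂ) =
      (Real.pi * v : ℂ)⁻¹ := by
    rw [← Complex.ofReal_mul, ← mul_inv, Real.mul_self_sqrt (by positivity)]
    push_cast
    rfl
  have hm' : (m.re : ℂ) ^ 2 + (m.im : ℂ) ^ 2 = v * q := by
    rw [Complex.sq_norm, Complex.normSq_apply] at hm
    exact_mod_cast (by rw [← hm]; ring : m.re ^ 2 + m.im ^ 2 = v * q)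
  have hE : Complex.exp (ξ * Complex.I * m.re ^ 2 / (1 - v * ξ * Complex.I)) *
      Complex.exp (ξ * Complex.I * m.im ^ 2 / (1 - v * ξ * Complex.I)) =
      Complex.exp (ξ * Complex.I * (v * q) / (1 - v * ξ * Complex.I)) := by
    rw [← Complex.exp_add, ← hm']
    congr 1
    ring
  have hden : (1 + ((v : ℝ) : ℂ) * -(ξ * Complex.I)) = 1 - v * ξ * Complex.I := by
    ring
  rw [noncentralMGF, hden]
  calc _ = ((((√(Real.pi * v))⁻¹ : ℝ) : ℂ) * (((√(Real.pi * v))⁻¹ : ℝ) : ℂ)) *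
        (B ^ (1 / 2 : ℂ) * B ^ (1 / 2 : ℂ)) *
        (Complex.exp (ξ * Complex.I * m.re ^ 2 / (1 - v * ξ * Complex.I)) *
      Complex.exp (ξ * Complex.I * m.im ^ 2 / (1 - v * ξ * Complex.I))) := by ring
    _ = _ := by
      rw [hs, hBB, hE, hBeq]
      have e2 : (ξ * Complex.I * (v * q) / (1 - v * ξ * Complex.I) : ℂ) =
          -(((v : ℝ) : ℂ) * -(ξ * Complex.I) / (1 - v * ξ * Complex.I) * q) := by
        ring
      rw [e2]
      field_simp

/-! ### Eigendecompositions of diagonal matrices -/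

/-- An eigendecomposition with distinct eigenvalues of a diagonal matrix is trivial: the unitary
factor is a permutation matrix up to phases. -/
theorem exists_perm_of_diagonal_eq_unitary_conj {K : ℕ} {d lam : Fin K → ℝ}
    {Ψ : Matrix (Fin K) (Fin K) ℂ} (hΨ : Ψ ∈ Matrix.unitaryGroup (Fin K) ℂ)
    (h : Matrix.diagonal (fun i => (d i : ℂ)) =
      Ψ * Matrix.diagonal (fun i => (lam i : ℂ)) * Ψᴴ) (hinj : Function.Injective lam) :
    ∃ π : Equiv.Perm (Fin K), ∀ a, d a = lam (π a) ∧
      ∀ μ : Fin K → ℂ, ‖(Ψᴴ *ᵥ μ) (π a)‖ = ‖μ a‖ := by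
  have h1 : Ψᴴ * Ψ = 1 := Matrix.mem_unitaryGroup_iff'.1 hΨ
  have h2 : Ψ * Ψᴴ = 1 := Matrix.mem_unitaryGroup_iff.1 hΨ
  have hent : ∀ a i, Ψ a i ≠ 0 → d a = lam i := by
    intro a i ha
    have e : Matrix.diagonal (fun i => (d i : ℂ)) * Ψ =
        Ψ * Matrix.diagonal (fun i => (lam i : ℂ)) := by
      rw [h, Matrix.mul_assoc, h1, Matrix.mul_one]
    have e' := congrFun (congrFun e a) i
    rw [Matrix.diagonal_mul, Matrix.mul_diagonal, mul_comm] at e'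
    exact_mod_cast mul_left_cancel₀ ha e'
  have hex : ∀ a, ∃ i, Ψ a i ≠ 0 := by
    intro a
    by_contra! hz
    have := congrFun (congrFun h2 a) a
    simp [Matrix.mul_apply, hz] at this
  choose π hπ using hex
  have hzero : ∀ a i, i ≠ π a → Ψ a i = 0 := by
    intro a i hi
    by_contra hne
    exact hi (hinj ((hent a i hne).symm.trans (hent a _ (hπ a))))
  have hrow : ∀ a b, Ψ a (π a) * star (Ψ b (π a)) = (1 : Matrix (Fin K) (Fin K) ℂ) a b := by
    intro a b
    rw [← h2, Matrix.mul_apply, Finset.sum_eq_single (π a)]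
    · rfl
    · intro j _ hj
      rw [hzero a j hj, zero_mul]
    · simp
  have hπinj : Function.Injective π := by
    intro a b hab
    by_contra hne
    have := hrow a b
    rw [Matrix.one_apply_ne hne, mul_eq_zero, star_eq_zero] at this
    rcases this with h | h
    · exact hπ a h
    · rw [hab] at h
      exact hπ b h
  refine ⟨Equiv.ofBijective π (Finite.injective_iff_bijective.1 hπinj),
    fun a => ⟨hent a _ (hπ a), fun μ => ?_⟩⟩
  have hnorm : ‖Ψ a (π a)‖ = 1 := by
    have := congrArg norm (hrow a a)
    rw [Matrix.one_apply_eq, norm_mul, norm_star, norm_one] at this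
    nlinarith [norm_nonneg (Ψ a (π a))]
  rw [Equiv.ofBijective_apply, Matrix.mulVec, dotProduct, Finset.sum_eq_single a]
  · rw [Matrix.conjTranspose_apply, norm_mul, norm_star, hnorm, one_mul]
  · intro b _ hb
    rw [Matrix.conjTranspose_apply, hzero b (π a) fun h => hb (hπinj h).symm, star_zero, zero_mul]
  · simp

/-! ### The interference vector and the outage event -/

namespace InterferenceChannel

variable {K Nt Nr : ℕ} {Ω : Type*}

theorem response_add (S : InterferenceChannel K Nt Nr) (k i : Fin K)
    (A B : Matrix (Fin Nr) (Fin Nt) ℂ) :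
    S.response k i (A + B) = S.response k i A + S.response k i B := by
  simp only [response, Matrix.add_mulVec, dotProduct_add]

/-- The error response is a fixed linear combination of the i.i.d. entries of `W_ki`. -/
theorem response_csiError (S : InterferenceChannel K Nt Nr)
    (W : Fin K → Fin K → Ω → Matrix (Fin Nr) (Fin Nt) ℂ) (k i : Fin K) (ω : Ω) :
    S.response k i (S.csiError W k i ω) = ∑ q : Fin Nr × Fin Nt,
      (star (S.u k) ᵥ* CFC.sqrt S.Sr) q.1 * (CFC.sqrt S.St *ᵥ S.v i) q.2 * W k i ω q.1 q.2 := by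
  rw [response, csiError, ← Matrix.mulVec_mulVec, ← Matrix.mulVec_mulVec, dotProduct_mulVec,
    Fintype.sum_prod_type]
  refine Finset.sum_congr rfl fun b _ => ?_
  rw [Matrix.mulVec, dotProduct, Finset.mul_sum]
  exact Finset.sum_congr rfl fun a _ => by ring

/-- The deterministic part of the interference vector `X_k`; it is also the mean of `X_k`. -/
noncomputable def nominalInterference (S : InterferenceChannel K Nt Nr) (k i : Fin K) : ℂ :=
  if i = k then 0 else S.response k i (S.Hhat k i)

theorem interference_eq_add (S : InterferenceChannel K Nt Nr)
    (W : Fin K → Fin K → Ω → Matrix (Fin Nr) (Fin Nt) ℂ) (k i : Fin K) (ω : Ω) :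
    S.interference W k ω i =
      S.nominalInterference k i + S.response k i (S.csiError W k i ω) := by
  rw [interference, nominalInterference]
  split_ifs with h
  · rw [h, zero_add]
  · rw [response_add]

variable [MeasurableSpace Ω] {P : Measure Ω} {S : InterferenceChannel K Nt Nr}
  {W : Fin K → Fin K → Ω → Matrix (Fin Nr) (Fin Nt) ℂ}

/-- The outage event is `{‖X_k‖² ≥ τ}`: the SINR is decreasing in the total interference power. -/
theorem outageProb_eq (k : Fin K) {R : ℝ} (hR : 0 < R) :
    S.outageProb W P k R =
      P.real {ω | S.threshold k R ≤ ∑ i, ‖S.interference W k ω i‖ ^ 2} := by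
  rw [outageProb]
  congr 1
  ext ω
  have hY : 0 ≤ ∑ i, ‖S.interference W k ω i‖ ^ 2 := by positivity
  have hden : ‖S.response k k (S.csiError W k k ω)‖ ^ 2
      + ∑ i ∈ Finset.univ.erase k, ‖S.response k i (S.Hhat k i + S.csiError W k i ω)‖ ^ 2 =
      ∑ i, ‖S.interference W k ω i‖ ^ 2 := by
    rw [← Finset.add_sum_erase _ _ (Finset.mem_univ k)]
    congr 1
    · simp [interference]
    · refine Finset.sum_congr rfl fun i hi => ?_
      rw [interference, if_neg (Finset.ne_of_mem_erase hi)]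
  have hpow : 0 < (2 : ℝ) ^ R - 1 := by
    linarith [Real.one_lt_rpow (by norm_num : (1 : ℝ) < 2) hR]
  have hD : 0 < ∑ i, ‖S.interference W k ω i‖ ^ 2 + S.sigma2 := by linarith [S.sigma2_pos]
  simp only [mem_ofPred_eq, sinr, threshold, hden]
  have hnum : 0 ≤ ‖S.response k k (S.Hhat k k)‖ ^ 2 := by positivity
  rw [Real.logb_le_iff_le_rpow (by norm_num) (by positivity), ← le_sub_iff_add_le',
    div_le_iff₀ hD, sub_le_iff_le_add, div_le_iff₀' hpow]

theorem IsKroneckerModel.iIndepFun_response (hW : S.IsKroneckerModel W P) (k : Fin K) :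
    iIndepFun (fun i ω => S.response k i (S.csiError W k i ω)) P := by
  have h := hW.indep_pair.precomp (g := fun i : Fin K => (k, i))
    fun i j hij => (Prod.mk.inj hij).2
  -- the error matrices enter `indep_pair` as functions of the pair of antenna indices
  refine h.comp (fun i E => S.response k i (Matrix.of fun b a => E (b, a))) fun i => ?_
  simp only [response, dotProduct, Matrix.mulVec, Matrix.of_apply]
  fun_prop

variable [IsProbabilityMeasure P]

/-- Each error response is complex Gaussian. Its variance
`σ_h² (u_kᴴ Σ_r u_k) (v_iᴴ Σ_t v_i)` is never needed in closed form. -/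
theorem IsKroneckerModel.exists_hasLaw_response (hW : S.IsKroneckerModel W P) (k i : Fin K) :
    ∃ v : ℝ≥0, HasLaw (fun ω => S.response k i (S.csiError W k i ω)) (complexGaussian v) P := by
  simp only [response_csiError]
  refine ⟨_, hasLaw_sum_complexGaussian
    (fun q => hasLaw_const_mul_complexGaussian (hW.law_entry k i q.1 q.2) _) ?_⟩
  exact (hW.indep_entry k i).comp _ fun q => measurable_const_mul
    ((star (S.u k) ᵥ* CFC.sqrt S.Sr) q.1 * (CFC.sqrt S.St *ᵥ S.v i) q.2)

theorem IsKroneckerModel.meanVec_eq (hW : S.IsKroneckerModel W P) (k : Fin K) :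
    S.meanVec W P k = S.nominalInterference k := by
  ext i
  obtain ⟨v, hv⟩ := hW.exists_hasLaw_response k i
  have hint : Integrable (fun ω => S.response k i (S.csiError W k i ω)) P := by
    have h := (memLp_two_id_complexGaussian v).integrable (by norm_num)
    rw [← hv.map_eq] at h
    exact h.comp_aemeasurable hv.aemeasurable
  have h0 : ∫ ω, S.response k i (S.csiError W k i ω) ∂P = 0 := by
    rw [hv.integral_eq, integral_id_complexGaussian]
  simp only [meanVec, interference_eq_add]
  rw [integral_add (integrable_const _) hint, h0]
  simp

/-- The links to user `k` are independent, so the covariance matrix of `X_k` is diagonal. -/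
theorem IsKroneckerModel.covMatrix_eq (hW : S.IsKroneckerModel W P) (k : Fin K) {v : Fin K → ℝ≥0}
    (hv : ∀ i, HasLaw (fun ω => S.response k i (S.csiError W k i ω)) (complexGaussian (v i)) P) :
    S.covMatrix W P k = Matrix.diagonal fun i => ((v i : ℝ) : ℂ) := by
  ext i j
  simp only [covMatrix, Matrix.of_apply, hW.meanVec_eq, interference_eq_add, add_sub_cancel_left]
  rcases eq_or_ne i j with rfl | hij
  · rw [Matrix.diagonal_apply_eq]
    exact ((hv i).integral_comp (f := fun z => z * star z)
      (Continuous.aestronglyMeasurable (by fun_prop))).trans (integral_mul_star_complexGaussian _)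
  · rw [Matrix.diagonal_apply_ne _ hij]
    have hstar : Measurable (star : ℂ → ℂ) := continuous_star.measurable
    have hind := ((hW.iIndepFun_response k).indepFun hij).comp measurable_id hstar
    have h := hind.integral_fun_mul_eq_mul_integral (hv i).aemeasurable.aestronglyMeasurable
      (hstar.comp_aemeasurable (hv j).aemeasurable).aestronglyMeasurable
    refine h.trans ?_
    have h0 : ∫ ω, (id ∘ fun ω => S.response k i (S.csiError W k i ω)) ω ∂P = 0 := by
      simp only [Function.comp_def, id]
      rw [(hv i).integral_eq, integral_id_complexGaussian]
    rw [h0, zero_mul]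

theorem IsKroneckerModel.aemeasurable_interference (hW : S.IsKroneckerModel W P) (k i : Fin K) :
    AEMeasurable (fun ω => S.interference W k ω i) P := by
  obtain ⟨v, hv⟩ := hW.exists_hasLaw_response k i
  simp only [interference_eq_add]
  exact hv.aemeasurable.const_add _

theorem IsKroneckerModel.charFun_interference (hW : S.IsKroneckerModel W P) (k : Fin K)
    {v : Fin K → ℝ≥0} (hv0 : ∀ i, v i ≠ 0)
    (hv : ∀ i, HasLaw (fun ω => S.response k i (S.csiError W k i ω)) (complexGaussian (v i)) P)
    {q : Fin K → ℝ} (hq : ∀ i, ‖S.nominalInterference k i‖ ^ 2 = v i * q i) (ξ : ℝ) :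
    charFun (P.map fun ω => ∑ i, ‖S.interference W k ω i‖ ^ 2) ξ =
      ∏ i, noncentralMGF (v i) (q i) (-(ξ * Complex.I)) := by
  have hmeas : AEMeasurable (fun ω => ∑ i, ‖S.interference W k ω i‖ ^ 2) P :=
    Finset.aemeasurable_fun_sum _ fun i _ => ((hW.aemeasurable_interference k i).norm.pow_const 2)
  rw [charFun_apply_real, integral_map hmeas (Continuous.aestronglyMeasurable (by fun_prop))]
  have e : ∀ ω, Complex.exp (ξ * (∑ i, ‖S.interference W k ω i‖ ^ 2 : ℝ) * Complex.I) =
      ∏ i, Complex.exp (ξ * (‖S.nominalInterference k i +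
        S.response k i (S.csiError W k i ω)‖ ^ 2 : ℝ) * Complex.I) := by
    intro ω
    rw [← Complex.exp_sum, Complex.ofReal_sum, Finset.mul_sum, Finset.sum_mul]
    simp only [interference_eq_add]
  simp only [e]
  rw [(hW.iIndepFun_response k).integral_fun_prod_comp
    (f := fun i z => Complex.exp (ξ * (‖S.nominalInterference k i + z‖ ^ 2 : ℝ) * Complex.I))
    (fun i => (hv i).aemeasurable) fun i => Continuous.aestronglyMeasurable (by fun_prop)]
  refine Finset.prod_congr rfl fun i _ => ?_
  rw [← integral_exp_normSq_complexGaussian (hv0 i) _ (hq i) ξ]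
  exact (hv i).integral_comp (f := fun z : ℂ =>
    Complex.exp (ξ * (‖S.nominalInterference k i + z‖ ^ 2 : ℝ) * Complex.I))
    (Continuous.aestronglyMeasurable (by fun_prop))

end InterferenceChannel

theorem corollary3 {K Nt Nr : ℕ} {Ω : Type*} [MeasurableSpace Ω]
    (P : Measure Ω) [IsProbabilityMeasure P]
    (S : InterferenceChannel K Nt Nr)
    (W : Fin K → Fin K → Ω → Matrix (Fin Nr) (Fin Nt) ℂ)
    (hW : S.IsKroneckerModel W P)
    (k : Fin K) (R : ℝ) (hR : 0 < R) (hτ : 0 ≤ S.threshold k R)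
    (hpos : (S.covMatrix W P k).PosDef)
    (Ψ : Matrix (Fin K) (Fin K) ℂ) (hΨ : Ψ ∈ Matrix.unitaryGroup (Fin K) ℂ)
    (lam : Fin K → ℝ)
    (hdecomp : S.covMatrix W P k = Ψ * Matrix.diagonal (fun i => (lam i : ℂ)) * Ψᴴ)
    (hdistinct : Function.Injective lam)
    (χ : Fin K → ℂ) (hχ : χ = whitenedMean Ψ lam (S.meanVec W P k))
    (τ : ℝ) (hτdef : τ = S.threshold k R) :
    (∀ i, Summable fun n : ℕ =>
      (1 / (n ! : ℂ)) ^ 2 * (((‖χ i‖ ^ 2 / lam i) ^ n : ℝ) : ℂ)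
        * iteratedDeriv n (gFun lam χ τ i) 0) ∧
    ((S.outageProb W P k R : ℝ) : ℂ) =
      -∑ i, ((Real.exp (-(‖χ i‖ ^ 2 + τ / lam i)) / lam i : ℝ) : ℂ) *
        ∑' n : ℕ, (1 / (n ! : ℂ)) ^ 2 * (((‖χ i‖ ^ 2 / lam i) ^ n : ℝ) : ℂ)
          * iteratedDeriv n (gFun lam χ τ i) 0 := by
  -- `k` witnesses that there is at least one user
  have : NeZero K := ⟨by rintro rfl; exact k.elim0⟩
  choose v hv using hW.exists_hasLaw_response k
  have hcov := hW.covMatrix_eq k hv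
  obtain ⟨π, hπ⟩ := exists_perm_of_diagonal_eq_unitary_conj (d := fun i => (v i : ℝ)) hΨ
    (hcov ▸ hdecomp) hdistinct
  have hv0 : ∀ i, v i ≠ 0 := by
    intro i h
    have := hpos.diag_pos (i := i)
    rw [hcov, Matrix.diagonal_apply_eq, h] at this
    simp at this
  have hlam : ∀ i, 0 < lam i := by
    intro i
    have := (hπ (π.symm i)).1
    rw [π.apply_symm_apply] at this
    rw [← this]
    exact_mod_cast pos_iff_ne_zero.2 (hv0 _)
  have hq : ∀ a, ‖S.nominalInterference k a‖ ^ 2 = v a * ‖χ (π a)‖ ^ 2 := by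
    intro a
    have hl := hlam (π a)
    rw [hχ, whitenedMean, Matrix.mulVec_diagonal, norm_mul, (hπ a).2, hW.meanVec_eq, (hπ a).1,
      Complex.norm_real, Real.norm_eq_abs, mul_pow, sq_abs, inv_pow, Real.sq_sqrt hl.le]
    field_simp
  have hmeas : AEMeasurable (fun ω => ∑ i, ‖S.interference W k ω i‖ ^ 2) P :=
    Finset.aemeasurable_fun_sum _ fun i _ => ((hW.aemeasurable_interference k i).norm.pow_const 2)
  have hchar : ∀ ξ : ℝ, charFun (P.map fun ω => ∑ i, ‖S.interference W k ω i‖ ^ 2) ξ =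
      ∏ i, noncentralMGF (lam i) (‖χ i‖ ^ 2) (-(ξ * Complex.I)) := by
    intro ξ
    rw [hW.charFun_interference k hv0 hv hq, ← Equiv.prod_comp π
      (fun i => noncentralMGF (lam i) (‖χ i‖ ^ 2) (-(ξ * Complex.I)))]
    exact Finset.prod_congr rfl fun a _ => by rw [(hπ a).1]
  have hout : S.outageProb W P k R =
      (P.map fun ω => ∑ i, ‖S.interference W k ω i‖ ^ 2).real (Ici τ) := by
    rw [S.outageProb_eq k hR, map_measureReal_apply_of_aemeasurable hmeas measurableSet_Ici, hτdef]
    rfl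
  rw [hout]
  exact measureReal_Ici_of_charFun_eq_prod hlam hdistinct χ hchar (hτdef ▸ hτ)
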